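/- Call a real number $c>0$ a Beck constant if for every finite set $P$ of $n$ points in the Euclidean plane $\mathbb R^2$ at least one of the following holds: (i) some line contains at least $n/100$ points of $P$; (ii) there are at least $c\,n^2$ distinct lines containing two or more points of $P$. For a prime $p$ and an integer $m\ge 1$ let $$\overline{\mathcal H}_{1,p^m}=\{(x,y)\in\mathbb Z^2 : xy\equiv 1 \pmod{p^m},\ 1\le x,y\le p^m-1\},$$ and for $1\le i\le p-1$ let $$C_i=\{(x,y)\in\overline{\mathcal H}_{1,p^m} : x\equiv i \pmod p\}.$$ Then a Beck constant exists, and for every Beck constant $c$, every prime $p$ and every integer $m\ge 1$ with $$p^{\lceil m/2\rceil-1}>200,$$ for each $i=1,\dots,p-1$ the number of lines in $\mathbb R^2$ spanned by $C_i$ (that is, lines containing at least two distinct points of $C_i$) is at least $c\,p^{2(m-1)}$. -/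

import Mathlib

/-- The Euclidean plane. -/
abbrev Plane : Type := EuclideanSpace ℝ (Fin 2)

/-- A line of the plane: a one-dimensional affine subspace. -/
def IsLine (L : AffineSubspace ℝ Plane) : Prop :=
  Module.finrank ℝ L.direction = 1

/-- The lines spanned by a set `S` of points: the lines that contain at least two distinct
points of `S`. -/
def spannedLines (S : Set Plane) : Set (AffineSubspace ℝ Plane) :=
  {L | IsLine L ∧ ∃ x ∈ S, ∃ y ∈ S, x ≠ y ∧ x ∈ L ∧ y ∈ L}

/-- `c` is a constant for which Beck's theorem holds: `c` is positive and, for every finite set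
`P` of points of the plane, with `n = #P`, some line contains at least `n / 100` points of `P`, or
at least `c * n ^ 2` distinct lines contain two or more points of `P`. -/
def IsBeckConstant (c : ℝ) : Prop :=
  0 < c ∧ ∀ P : Finset Plane,
    (∃ L : AffineSubspace ℝ Plane, IsLine L ∧
      (P.card : ℝ) / 100 ≤ (((P : Set Plane) ∩ (L : Set Plane)).ncard : ℝ)) ∨
    c * (P.card : ℝ) ^ 2 ≤ ((spannedLines (P : Set Plane)).ncard : ℝ)

/-- The least residues of the modular hyperbola `x * y ≡ a (mod n)`. -/
def modularHyperbola (a : ℤ) (n : ℕ) : Set (ℤ × ℤ) :=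
  {q | q.1 * q.2 ≡ a [ZMOD (n : ℤ)] ∧
    (1 ≤ q.1 ∧ q.1 ≤ (n : ℤ) - 1) ∧ (1 ≤ q.2 ∧ q.2 ≤ (n : ℤ) - 1)}

/-- The class `C_i`: the points of the modular hyperbola `x * y ≡ 1 (mod p ^ m)` with
`x ≡ i (mod p)`. -/
def hyperbolaClass (p m i : ℕ) : Set (ℤ × ℤ) :=
  {q | q ∈ modularHyperbola 1 (p ^ m) ∧ q.1 ≡ (i : ℤ) [ZMOD (p : ℤ)]}

/-- An integer point, as a point of the Euclidean plane. -/
noncomputable def toPlane (q : ℤ × ℤ) : Plane := !₂[(q.1 : ℝ), (q.2 : ℝ)]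

/-! The second claim follows from Beck's theorem once no line is rich in `C_i`. Put `⌈m / 2⌉ = h +
1`. On a line `a x + b y = c` with `p ∤ a`, the points of the hyperbola satisfy `a x² - c x + b ≡ 0
(mod p ^ m)`. Comparison with one solution `z` gives `(x - z)(a (x + z) - c) ≡ 0`, so `p ^ (h + 1)`
divides a factor and `x` lies in one of two classes modulo `p ^ (h + 1)`. Hence a line carries at
most `2 p ^ (m - h - 1)` points, while `C_i` has at least `p ^ (m - 1) > 200 p ^ (m - h - 1)`:
alternative (i) fails.

Beck's theorem rests on the crossing lemma (`crossing_lemma`), obtained by random sampling from the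
linear edge bound for crossing-free straight-line graphs. Joining consecutive points on rich lines
gives a graph with few crossings, since two lines meet at most once; this bounds the number of rich
lines (`card_rich_lines_le`). If no line is very rich, the moderately rich ones account for only a
fraction of the pairs of points, so the poor lines must be numerous. -/

/-! ### Non-vertical lines as affine functions -/

/-- The value at `t` of the affine function `t ↦ ℓ.1 * t + ℓ.2`. -/
def lineEval (ℓ : ℝ × ℝ) (t : ℝ) : ℝ := ℓ.1 * t + ℓ.2

/-- The affine function whose graph passes through `e.1` and `e.2`. -/
noncomputable def lineThrough (e : (ℝ × ℝ) × (ℝ × ℝ)) : ℝ × ℝ :=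
  ((e.2.2 - e.1.2) / (e.2.1 - e.1.1),
    e.1.2 - (e.2.2 - e.1.2) / (e.2.1 - e.1.1) * e.1.1)

theorem lineEval_lineThrough_left (e : (ℝ × ℝ) × (ℝ × ℝ)) :
    lineEval (lineThrough e) e.1.1 = e.1.2 := by
  simp [lineEval, lineThrough]

theorem lineEval_lineThrough_right {e : (ℝ × ℝ) × (ℝ × ℝ)} (h : e.1.1 ≠ e.2.1) :
    lineEval (lineThrough e) e.2.1 = e.2.2 := by
  have : e.2.1 - e.1.1 ≠ 0 := sub_ne_zero.2 h.symm
  simp only [lineEval, lineThrough]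
  field_simp
  ring

theorem eq_of_lineEval_eq {ℓ ℓ' : ℝ × ℝ} {s t : ℝ} (hst : s ≠ t)
    (hs : lineEval ℓ s = lineEval ℓ' s) (ht : lineEval ℓ t = lineEval ℓ' t) : ℓ = ℓ' := by
  simp only [lineEval] at hs ht
  have h1 : (ℓ.1 - ℓ'.1) * (s - t) = 0 := by linear_combination hs - ht
  have h2 : ℓ.1 = ℓ'.1 := by
    rcases mul_eq_zero.1 h1 with h | h
    · linarith
    · exact absurd (sub_eq_zero.1 h) hst
  refine Prod.ext h2 ?_
  rw [h2] at hs
  linarith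

theorem lineThrough_eq {ℓ : ℝ × ℝ} {a b : ℝ × ℝ} (hab : a.1 ≠ b.1)
    (ha : lineEval ℓ a.1 = a.2) (hb : lineEval ℓ b.1 = b.2) : lineThrough (a, b) = ℓ :=
  eq_of_lineEval_eq hab
    ((lineEval_lineThrough_left (a, b)).trans ha.symm)
    ((lineEval_lineThrough_right (e := (a, b)) hab).trans hb.symm)

theorem exists_lineEval_eq {ℓ ℓ' : ℝ × ℝ} {s u : ℝ} (hsu : s < u)
    (hs : lineEval ℓ s < lineEval ℓ' s) (hu : lineEval ℓ' u < lineEval ℓ u) :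
    ∃ t, s < t ∧ t < u ∧ lineEval ℓ t = lineEval ℓ' t := by
  have hc : Continuous fun t => lineEval ℓ t - lineEval ℓ' t := by
    unfold lineEval; fun_prop
  obtain ⟨t, ht, h0⟩ := intermediate_value_Ioo hsu.le hc.continuousOn
    (show (0 : ℝ) ∈ Set.Ioo _ _ from ⟨by linarith, by linarith⟩)
  exact ⟨t, ht.1, ht.2, by simpa [sub_eq_zero] using h0⟩

/-! ### Straight-line graphs and the planar edge bound -/

/-- A straight-line graph on the vertex set `V`, no two vertices of which have the same abscissa:
edges are given by their left and right endpoints, and contain no vertices in their interior. -/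
structure IsGeomGraph (V : Finset (ℝ × ℝ)) (E : Finset ((ℝ × ℝ) × (ℝ × ℝ))) : Prop where
  injOn : Set.InjOn Prod.fst (V : Set (ℝ × ℝ))
  left_mem : ∀ e ∈ E, e.1 ∈ V
  right_mem : ∀ e ∈ E, e.2 ∈ V
  lt : ∀ e ∈ E, e.1.1 < e.2.1
  not_mem_interior : ∀ e ∈ E, ∀ c ∈ V, e.1.1 < c.1 → c.1 < e.2.1 →
    lineEval (lineThrough e) c.1 ≠ c.2

/-- Two edges cross: their interiors meet. -/
def EdgesCross (e f : (ℝ × ℝ) × (ℝ × ℝ)) : Prop :=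
  ∃ t, (e.1.1 < t ∧ t < e.2.1) ∧ (f.1.1 < t ∧ t < f.2.1) ∧
    lineEval (lineThrough e) t = lineEval (lineThrough f) t

namespace IsGeomGraph

variable {V : Finset (ℝ × ℝ)} {E : Finset ((ℝ × ℝ) × (ℝ × ℝ))}

theorem mono {E' : Finset ((ℝ × ℝ) × (ℝ × ℝ))} (h : IsGeomGraph V E) (hE : E' ⊆ E) :
    IsGeomGraph V E' :=
  ⟨h.injOn, fun e he => h.left_mem e (hE he), fun e he => h.right_mem e (hE he),
    fun e he => h.lt e (hE he), fun e he => h.not_mem_interior e (hE he)⟩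

theorem eval_right (h : IsGeomGraph V E) {e} (he : e ∈ E) :
    lineEval (lineThrough e) e.2.1 = e.2.2 :=
  lineEval_lineThrough_right (h.lt e he).ne

theorem eq_of_fst_eq (h : IsGeomGraph V E) {a b : ℝ × ℝ} (ha : a ∈ V) (hb : b ∈ V)
    (hab : a.1 = b.1) : a = b := h.injOn ha hb hab

/-- If two overlapping collinear edges differed, an endpoint of one would be a vertex in the
interior of the other. -/
theorem eq_of_overlap (h : IsGeomGraph V E) {e f} (he : e ∈ E) (hf : f ∈ E)
    (hl : lineThrough e = lineThrough f) {t : ℝ} (h1 : e.1.1 < t) (h2 : t < e.2.1)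
    (h3 : f.1.1 < t) (h4 : t < f.2.1) : e = f := by
  have key : ∀ e ∈ E, ∀ f ∈ E, lineThrough e = lineThrough f → e.1.1 < t → t < e.2.1 →
      f.1.1 < t → t < f.2.1 → e.1.1 ≤ f.1.1 ∧ f.2.1 ≤ e.2.1 := by
    intro e he f hf hl h1 h2 h3 h4
    constructor
    · by_contra! hlt
      refine h.not_mem_interior f hf e.1 (h.left_mem e he) hlt (h1.trans h4) ?_
      rw [← hl, lineEval_lineThrough_left]
    · by_contra! hlt
      refine h.not_mem_interior f hf e.2 (h.right_mem e he) (h3.trans h2) hlt ?_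
      rw [← hl, h.eval_right he]
  have k1 := key e he f hf hl h1 h2 h3 h4
  have k2 := key f hf e he hl.symm h3 h4 h1 h2
  exact Prod.ext (h.eq_of_fst_eq (h.left_mem e he) (h.left_mem f hf) (le_antisymm k1.1 k2.1))
    (h.eq_of_fst_eq (h.right_mem e he) (h.right_mem f hf) (le_antisymm k2.2 k1.2))

theorem lineThrough_ne_of_cross (h : IsGeomGraph V E) {e f} (he : e ∈ E) (hf : f ∈ E)
    (hne : e ≠ f) (hc : EdgesCross e f) : lineThrough e ≠ lineThrough f := by
  obtain ⟨t, ⟨h1, h2⟩, ⟨h3, h4⟩, -⟩ := hc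
  exact fun hl => hne (h.eq_of_overlap he hf hl h1 h2 h3 h4)

theorem eq_of_slope_eq (h : IsGeomGraph V E) {e f} (he : e ∈ E) (hf : f ∈ E)
    (hl : e.1 = f.1) (hs : (lineThrough e).1 = (lineThrough f).1) : e = f := by
  have h1 := lineEval_lineThrough_left e
  have h2 := lineEval_lineThrough_left f
  have h3 : lineThrough e = lineThrough f := by
    refine Prod.ext hs ?_
    rw [hl] at h1
    simp only [lineEval] at h1 h2
    rw [hs] at h1
    linarith
  have h4 := h.lt e he
  have h5 := h.lt f hf
  have h6 : e.1.1 < min e.2.1 f.2.1 := lt_min h4 (by rw [hl]; exact h5)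
  obtain ⟨t, ht1, ht2⟩ := exists_between h6
  exact h.eq_of_overlap he hf h3 ht1 (ht2.trans_le (min_le_left _ _)) (by rw [← hl]; exact ht1)
    (ht2.trans_le (min_le_right _ _))

/-- `e` and `e'` are edges that leave the same vertex to the right, and `e'` is the next one
above `e`. -/
def Adjacent (E : Finset ((ℝ × ℝ) × (ℝ × ℝ))) (e e' : (ℝ × ℝ) × (ℝ × ℝ)) : Prop :=
  e.1 = e'.1 ∧ (lineThrough e).1 < (lineThrough e').1 ∧
    ∀ f ∈ E, f.1 = e.1 → (lineThrough e).1 < (lineThrough f).1 →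
      (lineThrough e').1 ≤ (lineThrough f).1

/-- The point `w` lies in the part of the wedge between `e` and `e'` to the left of the right
endpoints of both. -/
def InWedge (e e' : (ℝ × ℝ) × (ℝ × ℝ)) (w : ℝ × ℝ) : Prop :=
  e.1.1 < w.1 ∧ w.1 ≤ e.2.1 ∧ w.1 ≤ e'.2.1 ∧
    lineEval (lineThrough e) w.1 ≤ w.2 ∧ w.2 ≤ lineEval (lineThrough e') w.1

theorem Adjacent.eval_lt {e e'} (ha : Adjacent E e e') {t : ℝ} (ht : e.1.1 < t) :
    lineEval (lineThrough e) t < lineEval (lineThrough e') t := by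
  have h1 := lineEval_lineThrough_left e
  have h2 := lineEval_lineThrough_left e'
  rw [← ha.1] at h2
  simp only [lineEval] at *
  nlinarith [mul_pos (sub_pos.2 ha.2.1) (sub_pos.2 ht)]

/-- The nearer of the two right endpoints serves. -/
theorem exists_inWedge (h : IsGeomGraph V E) {e e'} (he : e ∈ E) (he' : e' ∈ E)
    (ha : Adjacent E e e') : ∃ w ∈ V, InWedge e e' w := by
  have h1 := h.lt e he
  have h2 := h.lt e' he'
  rw [← ha.1] at h2
  rcases le_total e.2.1 e'.2.1 with hle | hle
  · refine ⟨e.2, h.right_mem e he, h1, le_rfl, hle, (h.eval_right he).le, ?_⟩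
    rw [← h.eval_right he]
    exact (ha.eval_lt h1).le
  · refine ⟨e'.2, h.right_mem e' he', h2, hle, le_rfl, ?_, (h.eval_right he').ge⟩
    rw [← h.eval_right he']
    exact (ha.eval_lt h2).le

/-- No edge passes strictly through the wedge above or below its leftmost vertex. -/
theorem not_between (h : IsGeomGraph V E)
    (hnc : ∀ e ∈ E, ∀ f ∈ E, e ≠ f → ¬ EdgesCross e f)
    {e e' f} (he : e ∈ E) (he' : e' ∈ E) (hf : f ∈ E) (ha : Adjacent E e e') {w : ℝ × ℝ}
    (hw : InWedge e e' w) (hmin : ∀ w' ∈ V, InWedge e e' w' → w.1 ≤ w'.1)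
    (hfl : f.1.1 < w.1) (hfr : w.1 ≤ f.2.1)
    (h1 : lineEval (lineThrough e) w.1 < lineEval (lineThrough f) w.1)
    (h2 : lineEval (lineThrough f) w.1 < lineEval (lineThrough e') w.1) : False := by
  obtain ⟨hw1, hw2, hw3, -, -⟩ := hw
  have hee : e'.1 = e.1 := ha.1.symm
  -- Followed leftwards from `w`, the edge `f` stays between `e` and `e'`, since leaving the wedge
  -- would create a crossing.
  have below : ∀ s, e.1.1 ≤ s → f.1.1 ≤ s → s < w.1 →
      lineEval (lineThrough e) s ≤ lineEval (lineThrough f) s := by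
    intro s hs1 hs2 hs3
    by_contra! hlt
    obtain ⟨t, ht1, ht2, ht⟩ := exists_lineEval_eq hs3 hlt h1
    refine hnc f hf e he (by rintro rfl; exact lt_irrefl _ h1) ⟨t, ?_, ?_, ht⟩ <;>
      constructor <;> linarith
  have above : ∀ s, e.1.1 ≤ s → f.1.1 ≤ s → s < w.1 →
      lineEval (lineThrough f) s ≤ lineEval (lineThrough e') s := by
    intro s hs1 hs2 hs3
    by_contra! hlt
    obtain ⟨t, ht1, ht2, ht⟩ := exists_lineEval_eq hs3 hlt h2
    refine hnc e' he' f hf (by rintro rfl; exact lt_irrefl _ h2) ⟨t, ?_, ?_, ht⟩ <;>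
      constructor <;> (try rw [hee]) <;> linarith
  -- Either `f` starts inside the wedge, at a vertex left of `w`; or it starts at the apex, with a
  -- slope that adjacency forbids; or it runs through the apex, a vertex in its interior.
  rcases lt_trichotomy e.1.1 f.1.1 with hlt | heq | hlt
  · have b := below f.1.1 hlt.le le_rfl hfl
    have a := above f.1.1 hlt.le le_rfl hfl
    rw [lineEval_lineThrough_left] at a b
    have := hmin f.1 (h.left_mem f hf) ⟨hlt, by linarith, by linarith, b, a⟩
    linarith
  · have hv : e.1 = f.1 := h.eq_of_fst_eq (h.left_mem e he) (h.left_mem f hf) heq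
    have e1 := lineEval_lineThrough_left e
    have e2 := lineEval_lineThrough_left e'
    have e3 := lineEval_lineThrough_left f
    rw [hee] at e2
    rw [← hv] at e3
    simp only [lineEval] at *
    have hpos : 0 < w.1 - e.1.1 := by linarith
    have s1 : (lineThrough e).1 < (lineThrough f).1 := by
      by_contra! hc
      nlinarith [mul_nonneg (sub_nonneg.2 hc) hpos.le]
    have s2 := ha.2.2 f hf hv.symm s1
    nlinarith [mul_nonneg (sub_nonneg.2 s2) hpos.le]
  · have b := below e.1.1 le_rfl hlt.le hw1
    have a := above e.1.1 le_rfl hlt.le hw1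
    have e2 := lineEval_lineThrough_left e'
    rw [hee] at e2
    rw [lineEval_lineThrough_left] at b
    rw [e2] at a
    exact h.not_mem_interior f hf e.1 (h.left_mem e he) hlt (by linarith) (le_antisymm a b)

theorem Adjacent.left_unique (h : IsGeomGraph V E) {e e₁ e₂} (h₁ : e₁ ∈ E) (h₂ : e₂ ∈ E)
    (ha₁ : Adjacent E e₁ e) (ha₂ : Adjacent E e₂ e) : e₁ = e₂ := by
  refine h.eq_of_slope_eq h₁ h₂ (ha₁.1.trans ha₂.1.symm) ?_
  rcases lt_trichotomy (lineThrough e₁).1 (lineThrough e₂).1 with hlt | heq | hlt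
  · exact absurd (ha₁.2.2 e₂ h₂ (ha₂.1.trans ha₁.1.symm) hlt) (not_le.2 ha₂.2.1)
  · exact heq
  · exact absurd (ha₂.2.2 e₁ h₁ (ha₁.1.trans ha₂.1.symm) hlt) (not_le.2 ha₁.2.1)

/-- If two edges have the same height strictly to the right of their left endpoints, and are not
at their right endpoint there, they coincide. -/
theorem eq_of_eval_eq (hnc : ∀ e ∈ E, ∀ f ∈ E, e ≠ f → ¬ EdgesCross e f)
    (h : IsGeomGraph V E) {e f} (he : e ∈ E) (hf : f ∈ E) {w : ℝ × ℝ} (hw : w ∈ V)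
    (h1 : e.1.1 < w.1) (h2 : w.1 ≤ e.2.1) (h3 : f.1.1 < w.1) (h4 : w.1 ≤ f.2.1)
    (heq : lineEval (lineThrough e) w.1 = lineEval (lineThrough f) w.1)
    (hne : lineEval (lineThrough e) w.1 ≠ w.2) : e = f := by
  have key : ∀ g ∈ E, w.1 ≤ g.2.1 → lineEval (lineThrough g) w.1 ≠ w.2 → w.1 < g.2.1 := by
    intro g hg hle hne
    refine lt_of_le_of_ne hle fun hc => hne ?_
    rw [h.eq_of_fst_eq hw (h.right_mem g hg) hc]
    exact h.eval_right hg
  by_contra hc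
  exact hnc e he f hf hc
    ⟨w.1, ⟨h1, key e he h2 hne⟩, ⟨h3, key f hf h4 (heq ▸ hne)⟩, heq⟩

/-- A straight-line graph without crossings on `n` vertices has at most `3 n` edges. -/
theorem card_le_of_no_crossing (h : IsGeomGraph V E)
    (hnc : ∀ e ∈ E, ∀ f ∈ E, e ≠ f → ¬ EdgesCross e f) : E.card ≤ 3 * V.card := by
  classical
  -- Three classes of edges, each injecting into `V`. The first: the edge of greatest slope leaving
  -- its left endpoint, charged to that endpoint.
  have hT : (E.filter fun e => ∀ f ∈ E, f.1 = e.1 →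
      (lineThrough f).1 ≤ (lineThrough e).1).card ≤ V.card := by
    refine Finset.card_le_card_of_injOn Prod.fst
      (fun e he => h.left_mem e (Finset.mem_filter.1 he).1) ?_
    intro e he f hf hef
    simp only [Finset.coe_filter, Set.mem_ofPred_eq] at he hf
    exact h.eq_of_slope_eq he.1 hf.1 hef
      (le_antisymm (hf.2 e he.1 hef) (he.2 f hf.1 hef.symm))
  set N := E.filter fun e => ¬ ∀ f ∈ E, f.1 = e.1 →
      (lineThrough f).1 ≤ (lineThrough e).1 with hN
  have hnext : ∀ e ∈ N, ∃ e' ∈ E, Adjacent E e e' := by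
    intro e he
    obtain ⟨he, hne⟩ := Finset.mem_filter.1 he
    push Not at hne
    obtain ⟨f, hf, hfe, hlt⟩ := hne
    obtain ⟨g, hg, hmin⟩ := Finset.exists_min_image
      (E.filter fun g => g.1 = e.1 ∧ (lineThrough e).1 < (lineThrough g).1)
      (fun g => (lineThrough g).1) ⟨f, by simp [hf, hfe, hlt]⟩
    simp only [Finset.mem_filter] at hg hmin
    exact ⟨g, hg.1, hg.2.1.symm, hg.2.2, fun f hf hfe hlt => hmin f ⟨hf, hfe, hlt⟩⟩
  -- Every other edge is charged to the leftmost vertex `w` of the wedge between it and its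
  -- successor.
  have hw : ∀ e ∈ N, ∃ e' ∈ E, Adjacent E e e' ∧ ∃ w ∈ V, InWedge e e' w ∧
      ∀ w' ∈ V, InWedge e e' w' → w.1 ≤ w'.1 := by
    intro e he
    obtain ⟨e', he', ha⟩ := hnext e he
    obtain ⟨w₀, hw₀, hin⟩ := h.exists_inWedge (Finset.mem_filter.1 he).1 he' ha
    obtain ⟨w, hw, hmin⟩ := Finset.exists_min_image (V.filter (InWedge e e')) Prod.fst
      ⟨w₀, by simp [hw₀, hin]⟩
    simp only [Finset.mem_filter] at hw hmin
    exact ⟨e', he', ha, w, hw.1, hw.2, fun w' hw' hin' => hmin w' ⟨hw', hin'⟩⟩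
  choose! nx hnx hadj w hwV hin hmin using hw
  have hNE : ∀ e ∈ N, e ∈ E := fun e he => (Finset.mem_filter.1 he).1
  -- Second class: `w` strictly below the upper edge. If two wedges share `w`, the lower of their
  -- upper edges at `w` would pass strictly inside the other wedge, so the upper edges agree, and
  -- they determine the lower ones.
  have hU : (N.filter fun e => (w e).2 < lineEval (lineThrough (nx e)) (w e).1).card
      ≤ V.card := by
    refine Finset.card_le_card_of_injOn w
      (fun e he => hwV e (Finset.mem_filter.1 he).1) ?_
    intro e he f hf hef
    simp only [Finset.coe_filter, Set.mem_ofPred_eq] at he hf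
    obtain ⟨he, hue⟩ := he
    obtain ⟨hf, huf⟩ := hf
    have ie := hin e he
    have jf := hin f hf
    have le := ie.1
    have lf := jf.1
    rw [(hadj e he).1] at le
    rw [(hadj f hf).1] at lf
    have hnn : nx e = nx f := by
      rcases lt_trichotomy (lineEval (lineThrough (nx e)) (w e).1)
        (lineEval (lineThrough (nx f)) (w e).1) with hlt | heq | hlt
      · refine (h.not_between hnc (hNE f hf) (hnx f hf) (hnx e he) (hadj f hf) jf (hmin f hf)
          ?_ ?_ ?_ ?_).elim <;> rw [← hef]
        · exact le
        · exact ie.2.2.1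
        · exact lt_of_le_of_lt (hef ▸ jf.2.2.2.1) hue
        · exact hlt
      · exact eq_of_eval_eq hnc h (hnx e he) (hnx f hf) (hwV e he) le ie.2.2.1
          (hef ▸ lf) (hef ▸ jf.2.2.1) heq hue.ne'
      · refine (h.not_between hnc (hNE e he) (hnx e he) (hnx f hf) (hadj e he) ie (hmin e he)
          ?_ ?_ ?_ hlt).elim
        · exact hef ▸ lf
        · exact hef ▸ jf.2.2.1
        · rw [hef] at ie ⊢
          exact lt_of_le_of_lt ie.2.2.2.1 huf
    exact Adjacent.left_unique h (hNE e he) (hNE f hf) (hadj e he) (hnn ▸ hadj f hf)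
  -- Third class: `w` on the upper edge, hence strictly above the lower edge. The same argument
  -- applies to the lower edges.
  have hD : (N.filter fun e => ¬ (w e).2 < lineEval (lineThrough (nx e)) (w e).1).card
      ≤ V.card := by
    refine Finset.card_le_card_of_injOn w
      (fun e he => hwV e (Finset.mem_filter.1 he).1) ?_
    intro e he f hf hef
    simp only [Finset.coe_filter, Set.mem_ofPred_eq, not_lt] at he hf
    obtain ⟨he, hue⟩ := he
    obtain ⟨hf, huf⟩ := hf
    have ie := hin e he
    have jf := hin f hf
    have ue := ((hadj e he).eval_lt ie.1).trans_le hue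
    have uf := ((hadj f hf).eval_lt jf.1).trans_le huf
    rcases lt_trichotomy (lineEval (lineThrough e) (w e).1)
      (lineEval (lineThrough f) (w e).1) with hlt | heq | hlt
    · refine (h.not_between hnc (hNE e he) (hnx e he) (hNE f hf) (hadj e he) ie (hmin e he)
        ?_ ?_ hlt ?_).elim
      · exact hef ▸ jf.1
      · exact hef ▸ jf.2.1
      · rw [hef] at hue ⊢
        exact uf.trans_le (hef ▸ ie.2.2.2.2)
    · exact eq_of_eval_eq hnc h (hNE e he) (hNE f hf) (hwV e he) ie.1 ie.2.1
          (hef ▸ jf.1) (hef ▸ jf.2.1) heq ue.ne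
    · refine (h.not_between hnc (hNE f hf) (hnx f hf) (hNE e he) (hadj f hf) jf (hmin f hf)
        ?_ ?_ ?_ ?_).elim <;> rw [← hef]
      · exact ie.1
      · exact ie.2.1
      · exact hlt
      · exact ue.trans_le (hef ▸ jf.2.2.2.2)
  have s1 := Finset.card_filter_add_card_filter_not (s := E) (fun e => ∀ f ∈ E, f.1 = e.1 →
      (lineThrough f).1 ≤ (lineThrough e).1)
  have s2 := Finset.card_filter_add_card_filter_not (s := N)
    (fun e => (w e).2 < lineEval (lineThrough (nx e)) (w e).1)
  rw [← hN] at s1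
  omega

open Classical in
/-- The ordered pairs of crossing edges. -/
noncomputable def crossings (E : Finset ((ℝ × ℝ) × (ℝ × ℝ))) :
    Finset (((ℝ × ℝ) × (ℝ × ℝ)) × ((ℝ × ℝ) × (ℝ × ℝ))) :=
  (E ×ˢ E).filter fun q => q.1 ≠ q.2 ∧ EdgesCross q.1 q.2

theorem mem_crossings {q} : q ∈ crossings E ↔
    (q.1 ∈ E ∧ q.2 ∈ E) ∧ q.1 ≠ q.2 ∧ EdgesCross q.1 q.2 := by
  simp [crossings]

/-- Deleting an edge that takes part in a crossing lowers the number of crossings by at least one;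
induct until none is left. -/
theorem card_le_add_crossings (h : IsGeomGraph V E) :
    E.card ≤ 3 * V.card + (crossings E).card := by
  classical
  induction hn : E.card generalizing E with
  | zero => omega
  | succ n ih =>
    by_cases hnc : ∀ e ∈ E, ∀ f ∈ E, e ≠ f → ¬ EdgesCross e f
    · have := h.card_le_of_no_crossing hnc
      omega
    · push Not at hnc
      obtain ⟨e, he, f, hf, hef, hc⟩ := hnc
      have h1 := ih (h.mono (Finset.erase_subset e E)) (by rw [Finset.card_erase_of_mem he]; omega)
      have h2 : (crossings (E.erase e)).card < (crossings E).card := by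
        refine Finset.card_lt_card (Finset.ssubset_iff_subset_ne.2 ⟨fun q hq => ?_, fun heq => ?_⟩)
        · rw [mem_crossings] at hq ⊢
          exact ⟨⟨Finset.mem_of_mem_erase hq.1.1, Finset.mem_of_mem_erase hq.1.2⟩, hq.2⟩
        · have : (e, f) ∈ crossings (E.erase e) := by
            rw [heq, mem_crossings]
            exact ⟨⟨he, hf⟩, hef, hc⟩
          rw [mem_crossings] at this
          simp at this
      omega

end IsGeomGraph

/-! ### Random sampling and the crossing lemma -/

/-- A random subset of `V`, containing each element independently with probability `p`, contains
`T ⊆ V` with probability `p ^ #T`. -/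
theorem sum_powerset_weight {α : Type*} [DecidableEq α] {T V : Finset α} (hT : T ⊆ V) (p : ℝ) :
    ∑ S ∈ V.powerset, (if T ⊆ S then p ^ S.card * (1 - p) ^ (V.card - S.card) else 0)
      = p ^ T.card := by
  rw [← Finset.sum_filter]
  have h1 : ∑ S ∈ V.powerset.filter (T ⊆ ·), p ^ S.card * (1 - p) ^ (V.card - S.card)
      = ∑ U ∈ (V \ T).powerset, p ^ T.card *
          (p ^ U.card * (1 - p) ^ ((V \ T).card - U.card)) := by
    symm
    refine Finset.sum_bij' (fun U _ => T ∪ U) (fun S _ => S \ T) ?_ ?_ ?_ ?_ ?_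
    · intro U hU
      have hU := Finset.mem_powerset.1 hU
      simp only [Finset.mem_filter, Finset.mem_powerset]
      exact ⟨Finset.union_subset hT (hU.trans Finset.sdiff_subset), Finset.subset_union_left⟩
    · intro S hS
      simp only [Finset.mem_filter, Finset.mem_powerset] at hS ⊢
      exact Finset.sdiff_subset_sdiff hS.1 le_rfl
    · intro U hU
      have hU := Finset.mem_powerset.1 hU
      rw [Finset.union_sdiff_left, Finset.sdiff_eq_self_iff_disjoint]
      exact Finset.disjoint_of_subset_left hU Finset.sdiff_disjoint
    · intro S hS
      simp only [Finset.mem_filter, Finset.mem_powerset] at hS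
      exact Finset.union_sdiff_of_subset hS.2
    · intro U hU
      have hU := Finset.mem_powerset.1 hU
      have hd : Disjoint T U := (Finset.disjoint_of_subset_left hU Finset.sdiff_disjoint).symm
      rw [Finset.card_union_of_disjoint hd, Finset.card_sdiff_of_subset hT, pow_add,
        ← Nat.sub_sub]
      ring
  -- The remaining sum is the binomial expansion of `(p + (1 - p)) ^ #(V \ T) = 1`.
  rw [h1, ← Finset.mul_sum, Finset.sum_pow_mul_eq_add_pow]
  simp

/-- Summing over a random subset the number of elements of a finite set whose (`k` element) support
lies in the subset. -/
theorem sum_powerset_weight_mul_card {α β : Type*} [DecidableEq α] {V : Finset α} (A : Finset β)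
    (T : β → Finset α) (hT : ∀ b ∈ A, T b ⊆ V) (k : ℕ) (hk : ∀ b ∈ A, (T b).card = k) (p : ℝ) :
    ∑ S ∈ V.powerset, p ^ S.card * (1 - p) ^ (V.card - S.card) *
      ((A.filter fun b => T b ⊆ S).card : ℝ) = p ^ k * A.card := by
  have : ∀ S : Finset α, p ^ S.card * (1 - p) ^ (V.card - S.card) *
      ((A.filter fun b => T b ⊆ S).card : ℝ) =
      ∑ b ∈ A, if T b ⊆ S then p ^ S.card * (1 - p) ^ (V.card - S.card) else 0 := by
    intro S
    rw [← Finset.sum_filter, Finset.sum_const, nsmul_eq_mul, mul_comm]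
  simp_rw [this]
  rw [Finset.sum_comm, Finset.sum_congr rfl fun b hb =>
    (sum_powerset_weight (hT b hb) p).trans (by rw [hk b hb]), Finset.sum_const, nsmul_eq_mul,
    mul_comm]

namespace IsGeomGraph

variable {V : Finset (ℝ × ℝ)} {E : Finset ((ℝ × ℝ) × (ℝ × ℝ))}

/-- Crossing edges thus involve four distinct vertices, which is why a crossing survives sampling
with probability `p ^ 4`. A common left or right endpoint would give their two lines a second common
point. -/
theorem disjoint_of_cross (h : IsGeomGraph V E) {e f} (he : e ∈ E) (hf : f ∈ E)
    (hne : e ≠ f) (hc : EdgesCross e f) : e.1 ≠ f.1 ∧ e.1 ≠ f.2 ∧ e.2 ≠ f.1 ∧ e.2 ≠ f.2 := by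
  have hl := h.lineThrough_ne_of_cross he hf hne hc
  obtain ⟨t, ⟨h1, h2⟩, ⟨h3, h4⟩, ht⟩ := hc
  refine ⟨fun hv => hl ?_, fun hv => ?_, fun hv => ?_, fun hv => hl ?_⟩
  · refine eq_of_lineEval_eq h1.ne ?_ ht
    rw [lineEval_lineThrough_left, hv, lineEval_lineThrough_left]
  · rw [hv] at h1; linarith
  · rw [hv] at h2; linarith
  · refine eq_of_lineEval_eq h2.ne' ?_ ht
    rw [h.eval_right he, hv, h.eval_right hf]

theorem restrict (h : IsGeomGraph V E) {S : Finset (ℝ × ℝ)} (hS : S ⊆ V) :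
    IsGeomGraph S (E.filter fun e => ({e.1, e.2} : Finset (ℝ × ℝ)) ⊆ S) where
  injOn := h.injOn.mono hS
  left_mem e he := (Finset.mem_filter.1 he).2 (by simp)
  right_mem e he := (Finset.mem_filter.1 he).2 (by simp)
  lt e he := h.lt e (Finset.mem_filter.1 he).1
  not_mem_interior e he c hc := h.not_mem_interior e (Finset.mem_filter.1 he).1 c (hS hc)

/-- This is the expectation of `card_le_add_crossings` over the subgraph induced on a random vertex
set. -/
theorem sampling (h : IsGeomGraph V E) {p : ℝ} (h0 : 0 ≤ p) (h1 : p ≤ 1) :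
    p ^ 2 * E.card ≤ 3 * (p * V.card) + p ^ 4 * (crossings E).card := by
  have e1 := sum_powerset_weight_mul_card (V := V) E (fun e => {e.1, e.2})
    (fun e he => by
      simp [Finset.insert_subset_iff, h.left_mem e he, h.right_mem e he]) 2
    (fun e he => Finset.card_pair fun hc => (h.lt e he).ne (congrArg Prod.fst hc)) p
  have e2 := sum_powerset_weight_mul_card (V := V) V (fun v => {v}) (fun v hv => by simpa) 1
    (fun v hv => Finset.card_singleton v) p
  have e3 := sum_powerset_weight_mul_card (V := V) (crossings E)
    (fun q => {q.1.1, q.1.2, q.2.1, q.2.2})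
    (fun q hq => by
      obtain ⟨⟨ha, hb⟩, -⟩ := mem_crossings.1 hq
      simp [Finset.insert_subset_iff, h.left_mem _ ha, h.right_mem _ ha, h.left_mem _ hb,
        h.right_mem _ hb]) 4
    (fun q hq => by
      obtain ⟨⟨ha, hb⟩, hne, hc⟩ := mem_crossings.1 hq
      obtain ⟨d1, d2, d3, d4⟩ := h.disjoint_of_cross ha hb hne hc
      have d5 : q.1.1 ≠ q.1.2 := fun hc => (h.lt _ ha).ne (congrArg Prod.fst hc)
      have d6 : q.2.1 ≠ q.2.2 := fun hc => (h.lt _ hb).ne (congrArg Prod.fst hc)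
      rw [Finset.card_insert_of_notMem (by simp [d1, d2, d5]),
        Finset.card_insert_of_notMem (by simp [d3, d4]), Finset.card_pair d6]) p
  rw [pow_one] at e2
  rw [← e1, ← e2, ← e3, Finset.mul_sum, ← Finset.sum_add_distrib]
  refine Finset.sum_le_sum fun S hS => ?_
  have hS := Finset.mem_powerset.1 hS
  have hw : 0 ≤ p ^ S.card * (1 - p) ^ (V.card - S.card) :=
    mul_nonneg (pow_nonneg h0 _) (pow_nonneg (by linarith) _)
  have hG := (h.restrict hS).card_le_add_crossings
  have hSV : (V.filter fun v => ({v} : Finset (ℝ × ℝ)) ⊆ S) = S := by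
    ext v
    simpa using fun hv => hS hv
  have hX : crossings (E.filter fun e => ({e.1, e.2} : Finset (ℝ × ℝ)) ⊆ S) ⊆
      (crossings E).filter fun q => ({q.1.1, q.1.2, q.2.1, q.2.2} : Finset (ℝ × ℝ)) ⊆ S := by
    intro q hq
    simp only [mem_crossings, Finset.mem_filter, Finset.insert_subset_iff,
      Finset.singleton_subset_iff] at hq ⊢
    tauto
  have hX := Finset.card_le_card hX
  rw [hSV]
  have : ((E.filter fun e => ({e.1, e.2} : Finset (ℝ × ℝ)) ⊆ S).card : ℝ) ≤ 3 * S.card +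
      ((crossings E).filter fun q =>
        ({q.1.1, q.1.2, q.2.1, q.2.2} : Finset (ℝ × ℝ)) ⊆ S).card := by
    exact_mod_cast hG.trans (Nat.add_le_add_left hX _)
  calc _ ≤ _ := mul_le_mul_of_nonneg_left this hw
    _ = _ := by ring

/-- The crossing lemma for straight-line graphs. -/
theorem crossing_lemma (h : IsGeomGraph V E) (hE : 6 * V.card ≤ E.card) :
    (E.card : ℝ) ^ 3 ≤ 72 * (V.card : ℝ) ^ 2 * (crossings E).card := by
  rcases Nat.eq_zero_or_pos V.card with hV | hV
  · have : E = ∅ := by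
      refine Finset.eq_empty_of_forall_notMem fun e he => ?_
      rw [Finset.card_eq_zero] at hV
      simpa [hV] using h.left_mem e he
    simp [this]
    positivity
  have hn : (0 : ℝ) < V.card := by exact_mod_cast hV
  have hle : 6 * (V.card : ℝ) ≤ E.card := by exact_mod_cast hE
  have hm : (0 : ℝ) < E.card := by linarith
  -- With this probability `3 p n` is half of `p ^ 2 m`; the hypothesis `6 n ≤ m` makes it at most
  -- `1`.
  have hs := h.sampling (p := 6 * V.card / E.card) (by positivity) ((div_le_one hm).2 hle)
  generalize (V.card : ℝ) = n at *
  generalize (E.card : ℝ) = m at *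
  generalize ((crossings E).card : ℝ) = x at *
  have e : (3 * (6 * n / m * n) + (6 * n / m) ^ 4 * x - (6 * n / m) ^ 2 * m) * m ^ 4
      = 18 * n ^ 2 * (72 * n ^ 2 * x - m ^ 3) := by
    field_simp
    ring
  have h2 : 0 ≤ 18 * n ^ 2 * (72 * n ^ 2 * x - m ^ 3) := by
    rw [← e]
    exact mul_nonneg (by linarith) (by positivity)
  have h3 := nonneg_of_mul_nonneg_right h2 (by positivity)
  linarith

/-- Two lines give at most one crossing. -/
theorem card_crossings_le (h : IsGeomGraph V E) {L : Finset (ℝ × ℝ)}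
    (hL : ∀ e ∈ E, lineThrough e ∈ L) : (crossings E).card ≤ L.card ^ 2 := by
  rw [sq, ← Finset.card_product]
  refine Finset.card_le_card_of_injOn (fun q => (lineThrough q.1, lineThrough q.2)) ?_ ?_
  · intro q hq
    have := (mem_crossings.1 hq).1
    exact Finset.mem_product.2 ⟨hL _ this.1, hL _ this.2⟩
  · intro q hq r hr hqr
    obtain ⟨⟨q1, q2⟩, qne, qc⟩ := mem_crossings.1 hq
    obtain ⟨⟨r1, r2⟩, rne, rc⟩ := mem_crossings.1 hr
    have hl := h.lineThrough_ne_of_cross q1 q2 qne qc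
    obtain ⟨t, ⟨a1, a2⟩, ⟨a3, a4⟩, ht⟩ := qc
    obtain ⟨s, ⟨b1, b2⟩, ⟨b3, b4⟩, hs⟩ := rc
    obtain ⟨c1, c2⟩ := Prod.mk.inj hqr
    -- Distinct lines meet at one abscissa only, and on each line at most one edge covers it in its
    -- interior.
    have hts : t = s := by
      by_contra hts
      refine hl (eq_of_lineEval_eq hts ht ?_)
      rw [c1, c2]
      exact hs
    subst hts
    exact Prod.ext (h.eq_of_overlap q1 r1 c1 a1 a2 b1 b2) (h.eq_of_overlap q2 r2 c2 a3 a4 b3 b4)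

end IsGeomGraph

/-! ### Rich lines and connecting lines -/

/-- The points of `V` on the line `ℓ`. -/
noncomputable def pointsOn (V : Finset (ℝ × ℝ)) (ℓ : ℝ × ℝ) : Finset (ℝ × ℝ) :=
  V.filter fun v => lineEval ℓ v.1 = v.2

theorem mem_pointsOn {V : Finset (ℝ × ℝ)} {ℓ v : ℝ × ℝ} :
    v ∈ pointsOn V ℓ ↔ v ∈ V ∧ lineEval ℓ v.1 = v.2 := by
  simp [pointsOn]

/-- If each of a set of lines contains more than `j` of `n` points, the number of lines
is `O(n / j + n ^ 2 / j ^ 3)`. -/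
theorem card_rich_lines_le {V : Finset (ℝ × ℝ)} (hV : Set.InjOn Prod.fst (V : Set (ℝ × ℝ)))
    {L : Finset (ℝ × ℝ)} {j : ℕ} (hj : 1 ≤ j) (hL : ∀ ℓ ∈ L, j + 1 ≤ (pointsOn V ℓ).card) :
    (L.card : ℝ) ≤ 6 * V.card / j + 72 * V.card ^ 2 / j ^ 3 := by
  classical
  -- The edges join consecutive points of `V` on each line of `L`.
  set E : Finset ((ℝ × ℝ) × (ℝ × ℝ)) := (V ×ˢ V).filter fun e => e.1.1 < e.2.1 ∧
    lineThrough e ∈ L ∧ ∀ c ∈ V, e.1.1 < c.1 → c.1 < e.2.1 →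
      lineEval (lineThrough e) c.1 ≠ c.2 with hEdef
  have memE : ∀ e, e ∈ E ↔ (e.1 ∈ V ∧ e.2 ∈ V) ∧ e.1.1 < e.2.1 ∧
    lineThrough e ∈ L ∧ ∀ c ∈ V, e.1.1 < c.1 → c.1 < e.2.1 →
      lineEval (lineThrough e) c.1 ≠ c.2 := by
    intro e
    rw [hEdef, Finset.mem_filter, Finset.mem_product]
  have hG : IsGeomGraph V E :=
    ⟨hV, fun e he => ((memE e).1 he).1.1, fun e he => ((memE e).1 he).1.2,
      fun e he => ((memE e).1 he).2.1, fun e he => ((memE e).1 he).2.2.2⟩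
  have hEL : ∀ e ∈ E, lineThrough e ∈ L := fun e he => ((memE e).1 he).2.2.1
  have hcount : L.card * j ≤ E.card := by
    rw [Finset.card_eq_sum_card_fiberwise hEL, ← smul_eq_mul]
    refine Finset.card_nsmul_le_sum _ _ _ fun ℓ hℓ => ?_
    have hr := hL ℓ hℓ
    obtain ⟨z, hz, hzmax⟩ := Finset.exists_max_image (pointsOn V ℓ) Prod.fst
      (Finset.card_pos.1 (by omega))
    -- Every point but the rightmost is the left endpoint of the edge to its successor, so each line
    -- carries at least `j` edges.
    have hsub : (pointsOn V ℓ).erase z ⊆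
        (E.filter fun e => lineThrough e = ℓ).image Prod.fst := by
      intro a ha
      obtain ⟨haz, ha⟩ := Finset.mem_erase.1 ha
      have haV := mem_pointsOn.1 ha
      have haz1 : a.1 < z.1 := lt_of_le_of_ne (hzmax a ha) fun hc =>
        haz (hV haV.1 (mem_pointsOn.1 hz).1 hc)
      obtain ⟨b, hb, hbmin⟩ := Finset.exists_min_image
        ((pointsOn V ℓ).filter fun b => a.1 < b.1) Prod.fst ⟨z, by simp [hz, haz1]⟩
      obtain ⟨hb, hab⟩ := Finset.mem_filter.1 hb
      have hbV := mem_pointsOn.1 hb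
      have hl : lineThrough (a, b) = ℓ := lineThrough_eq hab.ne haV.2 hbV.2
      refine Finset.mem_image.2 ⟨(a, b), Finset.mem_filter.2 ⟨(memE _).2
        ⟨⟨haV.1, hbV.1⟩, hab, hl ▸ hℓ, fun c hc h1 h2 h3 => ?_⟩, hl⟩, rfl⟩
      have := hbmin c (Finset.mem_filter.2 ⟨mem_pointsOn.2 ⟨hc, hl ▸ h3⟩, h1⟩)
      exact absurd h2 (not_lt.2 this)
    have h1 := Finset.card_le_card hsub
    rw [Finset.card_erase_of_mem hz] at h1
    have h2 := h1.trans Finset.card_image_le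
    omega
  have hj0 : (0 : ℝ) < j := by exact_mod_cast hj
  have hc : (L.card : ℝ) * j ≤ E.card := by exact_mod_cast hcount
  rcases le_total (6 * V.card) E.card with hle | hle
  · have h1 := hG.crossing_lemma hle
    have h2 : ((IsGeomGraph.crossings E).card : ℝ) ≤ (L.card : ℝ) ^ 2 := by
      exact_mod_cast hG.card_crossings_le hEL
    have h3 : ((L.card : ℝ) * j) ^ 3 ≤ 72 * (V.card : ℝ) ^ 2 * (L.card : ℝ) ^ 2 :=
      (pow_le_pow_left₀ (by positivity) hc 3).trans
        (h1.trans (mul_le_mul_of_nonneg_left h2 (by positivity)))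
    have h4 : (L.card : ℝ) ≤ 72 * V.card ^ 2 / j ^ 3 := by
      rw [le_div_iff₀ (by positivity)]
      rcases L.card.eq_zero_or_pos with h0 | h0
      · rw [h0, Nat.cast_zero, zero_mul]; positivity
      · have h0 : (0 : ℝ) < L.card := by exact_mod_cast h0
        refine le_of_mul_le_mul_right ?_ (pow_pos h0 2)
        calc _ = ((L.card : ℝ) * j) ^ 3 := by ring
          _ ≤ _ := h3
    have : (0 : ℝ) ≤ 6 * V.card / j := by positivity
    linarith
  · have hle : (E.card : ℝ) ≤ 6 * V.card := by exact_mod_cast hle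
    have h4 : (L.card : ℝ) ≤ 6 * V.card / j := by
      rw [le_div_iff₀ hj0]; linarith
    have : (0 : ℝ) ≤ 72 * (V.card : ℝ) ^ 2 / j ^ 3 := by positivity
    linarith

/-- The lines through two points of `V`. -/
noncomputable def connectingLines (V : Finset (ℝ × ℝ)) : Finset (ℝ × ℝ) :=
  V.offDiag.image lineThrough

/-- The analytic form of Beck's theorem: if no line contains `n / 100` of the `n` points,
there are at least `n ^ 2 / 4000000` connecting lines. -/
theorem card_connectingLines_ge {V : Finset (ℝ × ℝ)}
    (hV : Set.InjOn Prod.fst (V : Set (ℝ × ℝ))) (hn : 100 ≤ V.card)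
    (hrich : ∀ ℓ ∈ connectingLines V, 100 * (pointsOn V ℓ).card ≤ V.card) :
    (V.card : ℝ) ^ 2 / 4000000 ≤ (connectingLines V).card := by
  set M := connectingLines V with hM
  set K := V.card / 100 with hK
  set r : ℝ × ℝ → ℕ := fun ℓ => (pointsOn V ℓ).card with hr
  -- Each ordered pair of distinct points lies on its connecting line.
  have hpairs : V.card * V.card - V.card ≤ ∑ ℓ ∈ M, r ℓ * (r ℓ - 1) := by
    rw [← Finset.offDiag_card, Finset.card_eq_sum_card_image lineThrough]
    refine Finset.sum_le_sum fun ℓ _ => ?_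
    rw [Nat.mul_sub_one, ← Finset.offDiag_card]
    refine Finset.card_le_card fun e he => ?_
    obtain ⟨he₀, rfl⟩ := Finset.mem_filter.1 he
    obtain ⟨h1, h2, h3⟩ := Finset.mem_offDiag.1 he₀
    have hne : e.1.1 ≠ e.2.1 := fun hc => h3 (hV h1 h2 hc)
    exact Finset.mem_offDiag.2 ⟨mem_pointsOn.2 ⟨h1, lineEval_lineThrough_left e⟩,
      mem_pointsOn.2 ⟨h2, lineEval_lineThrough_right hne⟩, h3⟩
  -- Uses `r (r - 1) = ∑ 2 j` over `1 ≤ j < r`; as `r ≤ K`, the range `j ≤ K` loses nothing.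
  have hsum : ∑ ℓ ∈ M, r ℓ * (r ℓ - 1) =
      ∑ j ∈ Finset.Icc 1 K, 2 * j * (M.filter fun ℓ => j + 1 ≤ r ℓ).card := by
    have : ∀ ℓ ∈ M, r ℓ * (r ℓ - 1) =
        ∑ j ∈ Finset.Icc 1 K, if j + 1 ≤ r ℓ then 2 * j else 0 := by
      intro ℓ hℓ
      have h1 := hrich ℓ hℓ
      rw [← Finset.sum_filter]
      have h2 : (Finset.Icc 1 K).filter (fun j => j + 1 ≤ r ℓ) = (Finset.range (r ℓ)).erase 0 := by
        ext j
        simp only [Finset.mem_filter, Finset.mem_Icc, Finset.mem_erase, Finset.mem_range, hr]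
        omega
      rw [h2, Finset.sum_erase _ (by simp), ← Finset.mul_sum, mul_comm 2, Finset.sum_range_id_mul_two]
    rw [Finset.sum_congr rfl this, Finset.sum_comm]
    refine Finset.sum_congr rfl fun j _ => ?_
    rw [← Finset.sum_filter, Finset.sum_const, smul_eq_mul, mul_comm]
  set n : ℝ := (V.card : ℝ) with hnr
  have hn' : (100 : ℝ) ≤ n := by rw [hnr]; exact_mod_cast hn
  have hKn : (K : ℝ) ≤ n / 100 := by
    rw [le_div_iff₀ (by norm_num)]
    rw [hnr]
    exact_mod_cast Nat.div_mul_le_self V.card 100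
  -- Poor levels `j ≤ 999` are bounded trivially by all of `M`; beyond them the rich-line bound
  -- gives `2 j (6 n / j + 72 n² / j³)`.
  have hj : ∀ j ∈ Finset.Icc 1 K, (2 * j * (M.filter fun ℓ => j + 1 ≤ r ℓ).card : ℝ) ≤
      (if j ≤ 999 then 2 * 999 * (M.card : ℝ) else 0) + 12 * n +
        (if 999 < j then 144 * n ^ 2 * ((j : ℝ) ^ 2)⁻¹ else 0) := by
    intro j hj
    obtain ⟨hj1, hjK⟩ := Finset.mem_Icc.1 hj
    have hj0 : (0 : ℝ) < j := by exact_mod_cast hj1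
    by_cases hjs : j ≤ 999
    · rw [if_pos hjs, if_neg (by omega)]
      have h1 : ((M.filter fun ℓ => j + 1 ≤ r ℓ).card : ℝ) ≤ M.card := by
        exact_mod_cast Finset.card_filter_le _ _
      have h2 : (j : ℝ) ≤ 999 := by exact_mod_cast hjs
      have h3 := mul_le_mul h2 h1 (by positivity) (by norm_num)
      linarith
    · rw [if_neg hjs, if_pos (by omega)]
      have h1 := card_rich_lines_le hV hj1 (L := M.filter fun ℓ => j + 1 ≤ r ℓ)
        fun ℓ hℓ => (Finset.mem_filter.1 hℓ).2
      have h2 := mul_le_mul_of_nonneg_left h1 (show (0 : ℝ) ≤ 2 * j by positivity)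
      refine h2.trans (le_of_eq ?_)
      rw [← hnr]
      field_simp
      ring
  have hbound : (∑ j ∈ Finset.Icc 1 K, 2 * j * (M.filter fun ℓ => j + 1 ≤ r ℓ).card : ℝ) ≤
      999 * (2 * 999 * (M.card : ℝ)) + K * (12 * n) + 144 * n ^ 2 * (2 / (999 + 1)) := by
    refine (Finset.sum_le_sum hj).trans ?_
    rw [Finset.sum_add_distrib, Finset.sum_add_distrib]
    refine add_le_add (add_le_add ?_ ?_) ?_
    · rw [← Finset.sum_filter, Finset.sum_const, nsmul_eq_mul]
      refine mul_le_mul_of_nonneg_right ?_ (by positivity)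
      have : ((Finset.Icc 1 K).filter fun j => j ≤ 999).card ≤ (Finset.Icc 1 999).card :=
        Finset.card_le_card fun j hj => by
          simp only [Finset.mem_filter, Finset.mem_Icc] at hj ⊢
          omega
      rw [Nat.card_Icc] at this
      exact_mod_cast this
    · simp
    · rw [← Finset.sum_filter, ← Finset.mul_sum]
      refine mul_le_mul_of_nonneg_left ?_ (by positivity)
      have := sum_Ioo_inv_sq_le (α := ℝ) 999 (K + 1)
      refine le_trans (le_of_eq ?_) (this.trans (by norm_num))
      refine Finset.sum_congr ?_ fun _ _ => rfl
      ext j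
      simp only [Finset.mem_filter, Finset.mem_Icc, Finset.mem_Ioo]
      omega
  have htotal : n * n - n ≤
      999 * (2 * 999 * (M.card : ℝ)) + K * (12 * n) + 144 * n ^ 2 * (2 / (999 + 1)) := by
    refine le_trans ?_ hbound
    have h1 := hpairs.trans_eq hsum
    have h2 : V.card * V.card ≤
        (∑ j ∈ Finset.Icc 1 K, 2 * j * (M.filter fun ℓ => j + 1 ≤ r ℓ).card) + V.card := by
      omega
    have h3 : n * n ≤
        (∑ j ∈ Finset.Icc 1 K, 2 * j * (M.filter fun ℓ => j + 1 ≤ r ℓ).card : ℝ) + n := by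
      rw [hnr]; exact_mod_cast h2
    linarith
  have h1 : (K : ℝ) * (12 * n) ≤ n / 100 * (12 * n) :=
    mul_le_mul_of_nonneg_right hKn (by positivity)
  have h2 : 100 * n ≤ n * n := mul_le_mul_of_nonneg_right hn' (by positivity)
  have h3 : (0 : ℝ) ≤ M.card := by positivity
  -- The losses are at most `0.01 n²`, `0.12 n²` and `0.288 n²`, so more than `n² / 2` is left,
  -- against fewer than `2000000 #M`.
  nlinarith

/-! ### Beck's theorem in the Euclidean plane -/

theorem isLine_affineSpan_pair {a b : Plane} (hab : a ≠ b) : IsLine line[ℝ, a, b] := by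
  rw [IsLine, direction_affineSpan, vectorSpan_pair]
  exact finrank_span_singleton (vsub_ne_zero.2 hab)

theorem IsLine.eq_affineSpan_pair {L : AffineSubspace ℝ Plane} (hL : IsLine L) {a b : Plane}
    (hab : a ≠ b) (ha : a ∈ L) (hb : b ∈ L) : line[ℝ, a, b] = L := by
  have hle : line[ℝ, a, b] ≤ L := affineSpan_pair_le_of_mem_of_mem ha hb
  refine AffineSubspace.eq_of_direction_eq_of_nonempty_of_le ?_
    ⟨a, left_mem_affineSpan_pair ℝ a b⟩ hle
  exact Submodule.eq_of_le_of_finrank_eq (AffineSubspace.direction_le hle)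
    ((isLine_affineSpan_pair hab).trans hL.symm)

theorem spannedLines_finite (P : Finset Plane) : (spannedLines (P : Set Plane)).Finite := by
  refine ((P ×ˢ P).finite_toSet.image fun q => line[ℝ, q.1, q.2]).subset ?_
  rintro L ⟨hL, x, hx, y, hy, hxy, hxL, hyL⟩
  exact ⟨(x, y), by simpa using ⟨hx, hy⟩, hL.eq_affineSpan_pair hxy hxL hyL⟩

/-- The linear coordinates `(x + ε y, y)` on the plane. -/
noncomputable def shear (ε : ℝ) (q : Plane) : ℝ × ℝ := (q 0 + ε * q 1, q 1)

theorem shear_injective (ε : ℝ) : Function.Injective (shear ε) := by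
  intro a b h
  simp only [shear, Prod.mk.injEq] at h
  obtain ⟨h0, h1⟩ := h
  rw [h1] at h0
  ext i
  fin_cases i
  · exact add_right_cancel h0
  · exact h1

/-- Each pair of points with distinct ordinates excludes one value of `ε`. After the shear no
connecting line is vertical. -/
theorem exists_shear_injOn (P : Finset Plane) :
    ∃ ε : ℝ, Set.InjOn (fun q => (shear ε q).1) (P : Set Plane) := by
  classical
  obtain ⟨ε, hε⟩ := Infinite.exists_notMem_finset
    ((P ×ˢ P).image fun q => (q.2 0 - q.1 0) / (q.1 1 - q.2 1))
  refine ⟨ε, fun a ha b hb hab => ?_⟩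
  have hab : a 0 + ε * a 1 = b 0 + ε * b 1 := hab
  by_cases h1 : a 1 = b 1
  · rw [h1] at hab
    exact shear_injective ε (Prod.ext (by simpa [shear, h1] using hab) h1)
  · refine (hε (Finset.mem_image.2 ⟨(a, b), Finset.mem_product.2 ⟨ha, hb⟩, ?_⟩)).elim
    have h1 : a 1 - b 1 ≠ 0 := sub_ne_zero.2 h1
    rw [div_eq_iff h1]
    linear_combination -hab

theorem mem_affineSpan_pair_iff_lineEval_shear {ε : ℝ} {a b : Plane}
    (hab : (shear ε a).1 ≠ (shear ε b).1) (c : Plane) :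
    c ∈ line[ℝ, a, b] ↔
      lineEval (lineThrough (shear ε a, shear ε b)) (shear ε c).1 = (shear ε c).2 := by
  have hd : (shear ε b).1 - (shear ε a).1 ≠ 0 := sub_ne_zero.2 hab.symm
  have hd' : (b 0 + ε * b 1) - (a 0 + ε * a 1) ≠ 0 := hd
  rw [mem_affineSpan_pair_iff_exists_lineMap_eq]
  constructor
  · rintro ⟨t, rfl⟩
    simp only [lineEval, lineThrough, shear, AffineMap.lineMap_apply, PiLp.add_apply,
      PiLp.smul_apply, PiLp.sub_apply, vsub_eq_sub, vadd_eq_add, smul_eq_mul]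
    linear_combination t * div_mul_cancel₀ (b 1 - a 1) hd'
  · intro h
    refine ⟨((shear ε c).1 - (shear ε a).1) / ((shear ε b).1 - (shear ε a).1),
      shear_injective ε ?_⟩
    have h' : c 1 = (b 1 - a 1) / ((b 0 + ε * b 1) - (a 0 + ε * a 1)) * (c 0 + ε * c 1) +
        (a 1 - (b 1 - a 1) / ((b 0 + ε * b 1) - (a 0 + ε * a 1)) * (a 0 + ε * a 1)) := h.symm
    simp only [shear, AffineMap.lineMap_apply, PiLp.add_apply,
      PiLp.smul_apply, PiLp.sub_apply, vsub_eq_sub, vadd_eq_add, smul_eq_mul, Prod.mk.injEq]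
    constructor
    · field_simp
      ring
    · linear_combination -h'

/-- Beck's theorem. -/
theorem isBeckConstant_inv : IsBeckConstant (1 / 4000000) := by
  classical
  refine ⟨by norm_num, fun P => ?_⟩
  by_contra! hcon
  obtain ⟨hpoor, hfew⟩ := hcon
  -- Applying the failure of (i) to one horizontal line rules out the empty set and, through a point
  -- of `P`, forces `#P > 100`.
  have hn : ∀ q : Plane, (((P : Set Plane) ∩ (line[ℝ, q, q + EuclideanSpace.single 0 1] :
      AffineSubspace ℝ Plane)).ncard : ℝ) < P.card / 100 :=
    fun q => hpoor _ (isLine_affineSpan_pair (by simp))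
  have hP : P.Nonempty := by
    rw [← Finset.card_pos, Nat.pos_iff_ne_zero]
    intro h0
    have := hn 0
    rw [h0, Nat.cast_zero, zero_div] at this
    exact absurd this (not_lt.2 (Nat.cast_nonneg _))
  obtain ⟨q, hq⟩ := hP
  have hcard : 100 ≤ P.card := by
    have h1 : 1 ≤ ((P : Set Plane) ∩ (line[ℝ, q, q + EuclideanSpace.single 0 1] :
        AffineSubspace ℝ Plane)).ncard :=
      (Set.ncard_pos (P.finite_toSet.inter_of_left _)).2
        ⟨q, hq, left_mem_affineSpan_pair ℝ _ _⟩
    have h2 : (1 : ℝ) < P.card / 100 := lt_of_le_of_lt (by exact_mod_cast h1) (hn q)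
    rw [lt_div_iff₀ (by norm_num)] at h2
    have : 1 * 100 < P.card := by exact_mod_cast h2
    omega
  obtain ⟨ε, hε⟩ := exists_shear_injOn P
  set V := P.image (shear ε) with hV
  have hVc : V.card = P.card := Finset.card_image_of_injective P (shear_injective ε)
  have hVinj : Set.InjOn Prod.fst (V : Set (ℝ × ℝ)) := by
    rw [hV, Finset.coe_image]
    rintro _ ⟨a, ha, rfl⟩ _ ⟨b, hb, rfl⟩ hab
    rw [hε ha hb hab]
  have hex : ∀ ℓ ∈ connectingLines V, ∃ a ∈ P, ∃ b ∈ P, a ≠ b ∧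
      lineThrough (shear ε a, shear ε b) = ℓ := by
    intro ℓ hℓ
    obtain ⟨⟨v, w⟩, he, rfl⟩ := Finset.mem_image.1 hℓ
    obtain ⟨hv, hw, hvw⟩ := Finset.mem_offDiag.1 he
    obtain ⟨a, ha, rfl⟩ := Finset.mem_image.1 hv
    obtain ⟨b, hb, rfl⟩ := Finset.mem_image.1 hw
    exact ⟨a, ha, b, hb, fun h => hvw (congrArg (shear ε) h), rfl⟩
  choose! a haP b hbP hab hl using hex
  have hfst : ∀ ℓ ∈ connectingLines V, (shear ε (a ℓ)).1 ≠ (shear ε (b ℓ)).1 :=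
    fun ℓ hℓ h => hab ℓ hℓ (hε (haP ℓ hℓ) (hbP ℓ hℓ) h)
  have hmem : ∀ ℓ ∈ connectingLines V, ∀ c : Plane, c ∈ line[ℝ, a ℓ, b ℓ] ↔
      lineEval ℓ (shear ε c).1 = (shear ε c).2 := by
    intro ℓ hℓ c
    rw [mem_affineSpan_pair_iff_lineEval_shear (hfst ℓ hℓ), hl ℓ hℓ]
  have hmain := card_connectingLines_ge hVinj (by omega) fun ℓ hℓ => by
    have h1 := hpoor _ (isLine_affineSpan_pair (hab ℓ hℓ))
    have h2 : pointsOn V ℓ = (P.filter fun c => c ∈ line[ℝ, a ℓ, b ℓ]).image (shear ε) := by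
      ext v
      simp only [mem_pointsOn, hV, Finset.mem_image, Finset.mem_filter, hmem ℓ hℓ]
      constructor
      · rintro ⟨⟨c, hc, rfl⟩, h⟩; exact ⟨c, ⟨hc, h⟩, rfl⟩
      · rintro ⟨c, ⟨hc, h⟩, rfl⟩; exact ⟨⟨c, hc, rfl⟩, h⟩
    have h3 : ((P : Set Plane) ∩ (line[ℝ, a ℓ, b ℓ] : AffineSubspace ℝ Plane)).ncard =
        (pointsOn V ℓ).card := by
      rw [h2, Finset.card_image_of_injective _ (shear_injective ε), ← Set.ncard_coe_finset,
        Finset.coe_filter]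
      rfl
    rw [h3, lt_div_iff₀ (by norm_num)] at h1
    have h4 : (pointsOn V ℓ).card * 100 < P.card := by exact_mod_cast h1
    omega
  have hinj : ((connectingLines V : Finset (ℝ × ℝ)) : Set (ℝ × ℝ)).ncard ≤
      (spannedLines (P : Set Plane)).ncard := by
    refine Set.ncard_le_ncard_of_injOn (fun ℓ => line[ℝ, a ℓ, b ℓ]) ?_ ?_ (spannedLines_finite P)
    · intro ℓ hℓ
      exact ⟨isLine_affineSpan_pair (hab ℓ hℓ), a ℓ, haP ℓ hℓ, b ℓ, hbP ℓ hℓ, hab ℓ hℓ,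
        left_mem_affineSpan_pair ℝ _ _, right_mem_affineSpan_pair ℝ _ _⟩
    · intro ℓ hℓ ℓ' hℓ' heq
      have heq : line[ℝ, a ℓ, b ℓ] = line[ℝ, a ℓ', b ℓ'] := heq
      rw [← hl ℓ hℓ]
      refine lineThrough_eq (hfst ℓ hℓ) ((hmem ℓ' hℓ' _).1 ?_) ((hmem ℓ' hℓ' _).1 ?_) <;>
        rw [← heq]
      · exact left_mem_affineSpan_pair ℝ _ _
      · exact right_mem_affineSpan_pair ℝ _ _
  rw [Set.ncard_coe_finset] at hinj
  have : ((connectingLines V).card : ℝ) ≤ (spannedLines (P : Set Plane)).ncard := by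
    exact_mod_cast hinj
  rw [hVc] at hmain
  linarith

/-! ### The modular hyperbola on a line -/

/-- Two valuations with sum at least `2 h + 1` cannot both be at most `h`. The induction removes one
factor `p` from both `a` and `b`. -/
theorem Prime.int_pow_dvd_or_pow_dvd_of_pow_dvd_mul {p : ℤ} (hp : Prime p) {h : ℕ} {a b : ℤ}
    (hd : p ^ (2 * h + 1) ∣ a * b) : p ^ (h + 1) ∣ a ∨ p ^ (h + 1) ∣ b := by
  induction h generalizing a b with
  | zero => simpa using hp.dvd_or_dvd (by simpa using hd)
  | succ h ih =>
    by_cases ha : p ∣ a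
    · by_cases hb : p ∣ b
      · obtain ⟨a, rfl⟩ := ha
        obtain ⟨b, rfl⟩ := hb
        have h0 : p ^ 2 ≠ 0 := pow_ne_zero _ hp.ne_zero
        have hd' : p ^ 2 * p ^ (2 * h + 1) ∣ p ^ 2 * (a * b) := by
          convert hd using 1 <;> ring
        rw [pow_succ' p (h + 1)]
        exact (ih ((mul_dvd_mul_iff_left h0).1 hd')).imp (mul_dvd_mul_left p) (mul_dvd_mul_left p)
      · exact Or.inl ((pow_dvd_pow p (by omega)).trans (hp.pow_dvd_of_dvd_mul_right _ hb hd))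
    · exact Or.inr ((pow_dvd_pow p (by omega)).trans (hp.pow_dvd_of_dvd_mul_left _ ha hd))

theorem Int.card_Ico_mul_filter_modEq {r : ℤ} (hr : 0 < r) (k : ℕ) (v : ℤ) :
    ((Finset.Ico 0 (k * r)).filter fun x => x ≡ v [ZMOD r]).card = k := by
  have h := Int.Ico_filter_modEq_card 0 (k * r) hr v
  have hr' : (r : ℚ) ≠ 0 := by exact_mod_cast hr.ne'
  have e : (((k * r : ℤ) : ℚ) - v) / r = (((0 : ℤ) : ℚ) - v) / r + (k : ℤ) := by
    push_cast
    field_simp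
    ring
  rw [e, Int.ceil_add_intCast, add_sub_cancel_left] at h
  omega

/-- Integral points in a strip of abscissae `[0, k r)`, lying in one residue class modulo `r` and
determined by their abscissae. -/
theorem card_le_of_forall_modEq {S : Finset (ℤ × ℤ)} {r : ℤ} (hr : 0 < r) (k : ℕ)
    (hinj : Set.InjOn Prod.fst (S : Set (ℤ × ℤ)))
    (hS : ∀ q ∈ S, 0 ≤ q.1 ∧ q.1 < k * r) (hmod : ∀ q ∈ S, ∀ q' ∈ S, r ∣ q.1 - q'.1) :
    S.card ≤ k := by
  rcases S.eq_empty_or_nonempty with rfl | ⟨z, hz⟩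
  · simp
  · rw [← Int.card_Ico_mul_filter_modEq hr k z.1]
    refine Finset.card_le_card_of_injOn Prod.fst (fun q hq => ?_) hinj
    have h1 := hmod z hz q hq
    exact Finset.mem_filter.2 ⟨Finset.mem_Ico.2 (hS q hq), Int.modEq_iff_dvd.2 h1⟩

theorem modularHyperbola_injOn_fst (n : ℕ) :
    Set.InjOn Prod.fst (modularHyperbola 1 n) := by
  rintro ⟨x, y⟩ ⟨hq, -, hy⟩ ⟨x', y'⟩ ⟨hq', -, hy'⟩ (rfl : x = x')
  dsimp only at *
  have h1 : y ≡ y' [ZMOD n] := by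
    calc y = y * 1 := by ring
      _ ≡ y * (x * y') [ZMOD n] := (hq'.symm.mul_left y)
      _ = (x * y) * y' := by ring
      _ ≡ 1 * y' [ZMOD n] := hq.mul_right y'
      _ = y' := by ring
  have h2 : y = y' := by
    rw [Int.ModEq, Int.emod_eq_of_lt (by omega) (by omega),
      Int.emod_eq_of_lt (by omega) (by omega)] at h1
    exact h1
  rw [h2]

theorem modularHyperbola_swap {n : ℕ} {q : ℤ × ℤ} (hq : q ∈ modularHyperbola 1 n) :
    q.swap ∈ modularHyperbola 1 n :=
  ⟨by simpa [mul_comm] using hq.1, hq.2.2, hq.2.1⟩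

/-- A line `a x + b y = c` with `p ∤ a` contains at most `2 p ^ ⌊m / 2⌋` points of the modular
hyperbola modulo `p ^ m`. Here `⌈m / 2⌉ = h + 1`. -/
theorem card_hyperbola_line_le_of_not_dvd {p m h : ℕ} (hp : p.Prime) (hhm : h + 1 ≤ m)
    (hmh : 2 * h + 1 ≤ m) {a b c : ℤ} (ha : ¬ (p : ℤ) ∣ a)
    {S : Finset (ℤ × ℤ)} (hS : ∀ q ∈ S, q ∈ modularHyperbola 1 (p ^ m))
    (hl : ∀ q ∈ S, a * q.1 + b * q.2 = c) : S.card ≤ 2 * p ^ (m - (h + 1)) := by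
  classical
  have hpi : Prime (p : ℤ) := Nat.prime_iff_prime_int.1 hp
  rcases S.eq_empty_or_nonempty with rfl | ⟨z, hz⟩
  · simp
  have hr : (0 : ℤ) < (p : ℤ) ^ (h + 1) := pow_pos (by exact_mod_cast hp.pos) _
  have hinj : Set.InjOn Prod.fst (S : Set (ℤ × ℤ)) :=
    (modularHyperbola_injOn_fst _).mono hS
  have hpow : ((p ^ (m - (h + 1)) : ℕ) : ℤ) * (p : ℤ) ^ (h + 1) = ((p ^ m : ℕ) : ℤ) := by
    push_cast
    rw [← pow_add, Nat.sub_add_cancel hhm]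
  have hrange : ∀ q ∈ S, 0 ≤ q.1 ∧ q.1 < ((p ^ (m - (h + 1)) : ℕ) : ℤ) * (p : ℤ) ^ (h + 1) := by
    intro q hq
    have := (hS q hq).2.1
    rw [hpow]
    omega
  -- Multiply the line equation by `x` and use `x y ≡ 1`.
  have hquad : ∀ q ∈ S, ((p ^ m : ℕ) : ℤ) ∣ a * q.1 ^ 2 - c * q.1 + b := by
    intro q hq
    have h1 := (hS q hq).1.dvd
    have h2 := hl q hq
    have : a * q.1 ^ 2 - c * q.1 + b = b * (1 - q.1 * q.2) := by rw [← h2]; ring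
    rw [this]
    exact h1.mul_left b
  have hor : ∀ q ∈ S, ¬ (p : ℤ) ^ (h + 1) ∣ q.1 - z.1 →
      (p : ℤ) ^ (h + 1) ∣ a * (q.1 + z.1) - c := by
    intro q hq hnd
    have h1 := dvd_sub (hquad q hq) (hquad z hz)
    have h2 : a * q.1 ^ 2 - c * q.1 + b - (a * z.1 ^ 2 - c * z.1 + b) =
      (q.1 - z.1) * (a * (q.1 + z.1) - c) := by ring
    rw [h2] at h1
    push_cast at h1
    exact (hpi.int_pow_dvd_or_pow_dvd_of_pow_dvd_mul ((pow_dvd_pow _ hmh).trans h1)).resolve_left hnd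
  -- The two roots modulo `p ^ (h + 1)`: `x ≡ z`, and `a x ≡ c - a z`, a single class because `p ∤
  -- a`.
  rw [← Finset.card_filter_add_card_filter_not (s := S)
    fun q => (p : ℤ) ^ (h + 1) ∣ q.1 - z.1, two_mul]
  refine add_le_add ?_ ?_ <;>
    refine card_le_of_forall_modEq hr _ (hinj.mono (Finset.coe_subset.2 (Finset.filter_subset _ _)))
      (fun q hq => hrange q (Finset.mem_filter.1 hq).1) fun q hq q' hq' => ?_
  · simpa using dvd_sub (Finset.mem_filter.1 hq).2 (Finset.mem_filter.1 hq').2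
  · have h1 := hor q (Finset.mem_filter.1 hq).1 (Finset.mem_filter.1 hq).2
    have h2 := hor q' (Finset.mem_filter.1 hq').1 (Finset.mem_filter.1 hq').2
    have h3 := dvd_sub h1 h2
    have h4 : a * (q.1 + z.1) - c - (a * (q'.1 + z.1) - c) = a * (q.1 - q'.1) := by ring
    rw [h4] at h3
    exact hpi.pow_dvd_of_dvd_mul_left _ ha h3

/-- Coprimality keeps `p` from dividing both coefficients, and the hyperbola is symmetric under
exchange of coordinates. -/
theorem card_hyperbola_line_le {p m h : ℕ} (hp : p.Prime) (hhm : h + 1 ≤ m)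
    (hmh : 2 * h + 1 ≤ m) {a b c : ℤ} (hab : IsCoprime a b)
    {S : Finset (ℤ × ℤ)} (hS : ∀ q ∈ S, q ∈ modularHyperbola 1 (p ^ m))
    (hl : ∀ q ∈ S, a * q.1 + b * q.2 = c) : S.card ≤ 2 * p ^ (m - (h + 1)) := by
  classical
  by_cases ha : (p : ℤ) ∣ a
  · have hb : ¬ (p : ℤ) ∣ b := fun hb =>
      (Nat.prime_iff_prime_int.1 hp).not_isUnit (hab.isUnit_of_dvd' ha hb)
    rw [← Finset.card_image_of_injective S Prod.swap_injective]
    refine card_hyperbola_line_le_of_not_dvd (b := a) (c := c) hp hhm hmh hb ?_ ?_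
    · simp only [Finset.mem_image]
      rintro _ ⟨q, hq, rfl⟩
      exact modularHyperbola_swap (hS q hq)
    · simp only [Finset.mem_image]
      rintro _ ⟨q, hq, rfl⟩
      rw [← hl q hq]
      simp [add_comm]
  · exact card_hyperbola_line_le_of_not_dvd hp hhm hmh ha hS hl

/-! ### Integer points on real lines, and the classes `C_i` -/

theorem toPlane_injective : Function.Injective toPlane := by
  intro q q' h
  have h0 := congrFun (congrArg WithLp.ofLp h) 0
  have h1 := congrFun (congrArg WithLp.ofLp h) 1
  simp [toPlane] at h0 h1
  exact Prod.ext h0 h1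

theorem modularHyperbola_finite (a : ℤ) (n : ℕ) : (modularHyperbola a n).Finite :=
  ((Set.finite_Icc (1 : ℤ) (n - 1)).prod (Set.finite_Icc (1 : ℤ) (n - 1))).subset
    fun _ hq => ⟨hq.2.1, hq.2.2⟩

/-- Distinct integral points span a line with coprime integral coefficients. -/
theorem exists_integral_equation {L : AffineSubspace ℝ Plane} (hL : IsLine L) {q₁ q₂ : ℤ × ℤ}
    (hne : q₁ ≠ q₂) (h₁ : toPlane q₁ ∈ L) (h₂ : toPlane q₂ ∈ L) :
    ∃ a b c : ℤ, IsCoprime a b ∧ ∀ q : ℤ × ℤ, toPlane q ∈ L → a * q.1 + b * q.2 = c := by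
  -- `(a, b)` is the normal vector to `q₂ - q₁`, divided by the gcd of its entries.
  obtain ⟨a, b, g, hg, hab, ha, hb⟩ : ∃ a b g : ℤ, g ≠ 0 ∧ IsCoprime a b ∧
      q₂.2 - q₁.2 = a * g ∧ q₂.1 - q₁.1 = - b * g := by
    have hgcd : 0 < Int.gcd (q₂.2 - q₁.2) (q₁.1 - q₂.1) := by
      rw [Nat.pos_iff_ne_zero, Ne, Int.gcd_eq_zero_iff]
      rintro ⟨h1, h2⟩
      exact hne (Prod.ext (by omega) (by omega))
    obtain ⟨a, b, h1, h2, h3⟩ := Int.exists_gcd_one hgcd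
    exact ⟨a, b, _, by exact_mod_cast hgcd.ne', Int.isCoprime_iff_gcd_eq_one.2 h1, h2,
      by linear_combination -h3⟩
  refine ⟨a, b, a * q₁.1 + b * q₁.2, hab, fun q hq => ?_⟩
  have hd₂ := AffineSubspace.vsub_mem_direction h₂ h₁
  have hd := AffineSubspace.vsub_mem_direction hq h₁
  have hv0 : toPlane q₂ -ᵥ toPlane q₁ ≠ 0 := vsub_ne_zero.2 (toPlane_injective.ne hne.symm)
  obtain ⟨t, ht⟩ := (finrank_eq_one_iff_of_nonzero' (⟨_, hd₂⟩ : L.direction)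
    (by simpa [Subtype.ext_iff] using hv0)).1 hL ⟨_, hd⟩
  have ht := congrArg Subtype.val ht
  have e0 := congrFun (congrArg WithLp.ofLp ht) 0
  have e1 := congrFun (congrArg WithLp.ofLp ht) 1
  simp [toPlane] at e0 e1
  have ha' : (q₂.2 : ℝ) - q₁.2 = a * g := by exact_mod_cast ha
  have hb' : (q₂.1 : ℝ) - q₁.1 = - b * g := by exact_mod_cast hb
  have : (a : ℝ) * q.1 + b * q.2 = a * q₁.1 + b * q₁.2 := by
    linear_combination (-a) * e0 - b * e1 + a * t * hb' + b * t * ha'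
  exact_mod_cast this

/-- Each abscissa `i + p k` with `k < p ^ (m - 1)` is prime to `p`, hence has an inverse modulo `p ^
m`. -/
theorem pow_le_card_hyperbolaClass {p m i : ℕ} (hp : p.Prime) (hm : 1 ≤ m) (hi : 1 ≤ i)
    (hip : i ≤ p - 1) : p ^ (m - 1) ≤ (hyperbolaClass p m i).ncard := by
  have hp1 := hp.one_lt
  have hfin : (hyperbolaClass p m i).Finite :=
    (modularHyperbola_finite _ _).subset fun _ hq => hq.1
  have hpm : p ^ m = p * p ^ (m - 1) := by
    rw [← pow_succ', Nat.sub_add_cancel hm]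
  have hex : ∀ k < p ^ (m - 1), ∃ y : ℤ, (((i + p * k : ℕ) : ℤ), y) ∈ hyperbolaClass p m i := by
    intro k hk
    have hlt : i + p * k < p ^ m := by
      rw [hpm]
      calc i + p * k < p + p * k := by omega
        _ = p * (k + 1) := by ring
        _ ≤ _ := Nat.mul_le_mul_left _ hk
    have hcop : Nat.Coprime (i + p * k) (p ^ m) := by
      refine Nat.Coprime.pow_right m ?_
      rw [Nat.coprime_add_mul_left_left, Nat.coprime_comm]
      exact Nat.coprime_of_lt_prime (by omega) (by omega) hp
    have hn1 : 1 < p ^ m := Nat.one_lt_pow (by omega) hp1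
    obtain ⟨y, hylt, hy⟩ := Nat.exists_mul_mod_eq_one_of_coprime hcop hn1
    have hy0 : y ≠ 0 := by
      rintro rfl
      simp at hy
    refine ⟨y, ⟨?_, ?_, ?_⟩, ?_⟩
    · have : (i + p * k) * y ≡ 1 [MOD p ^ m] := by
        rw [Nat.ModEq, hy, Nat.mod_eq_of_lt hn1]
      have := Int.natCast_modEq_iff.2 this
      rwa [Nat.cast_mul, Nat.cast_one] at this
    · dsimp only
      have : 1 ≤ i + p * k := by omega
      omega
    · dsimp only
      omega
    · simp [Int.ModEq]
  choose! y hy using hex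
  have hinj : Set.InjOn (fun k : ℕ => (((i + p * k : ℕ) : ℤ), y k))
      (Finset.range (p ^ (m - 1)) : Set ℕ) := by
    intro k _ k' _ h
    have h1 := (Prod.mk.inj h).1
    have h2 : i + p * k = i + p * k' := by exact_mod_cast h1
    exact Nat.eq_of_mul_eq_mul_left hp.pos (by omega)
  have := Set.ncard_le_ncard (s := (fun k : ℕ => (((i + p * k : ℕ) : ℤ), y k)) ''
    (Finset.range (p ^ (m - 1)) : Set ℕ)) (t := hyperbolaClass p m i)
    (by rintro _ ⟨k, hk, rfl⟩; exact hy k (by simpa using hk)) hfin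
  rwa [hinj.ncard_image, Set.ncard_coe_finset, Finset.card_range] at this

theorem beck_hyperbolaClass {c : ℝ} (hc : IsBeckConstant c) {p m : ℕ} (hp : p.Prime) (hm : 1 ≤ m)
    (hpm : 200 < p ^ (⌈(m : ℚ) / 2⌉₊ - 1)) {i : ℕ} (hi : 1 ≤ i) (hip : i ≤ p - 1) :
    c * (p : ℝ) ^ (2 * (m - 1)) ≤
      ((spannedLines (toPlane '' hyperbolaClass p m i)).ncard : ℝ) := by
  classical
  have hfin : (hyperbolaClass p m i).Finite :=
    (modularHyperbola_finite _ _).subset fun _ hq => hq.1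
  have hcard := pow_le_card_hyperbolaClass hp hm hi hip
  set H := hfin.toFinset with hH
  have hHc : (hyperbolaClass p m i) = (H : Set (ℤ × ℤ)) := by simp [hH]
  rw [hHc, Set.ncard_coe_finset] at hcard
  rw [hHc]
  have hPc : (H.image toPlane).card = H.card := Finset.card_image_of_injective _ toPlane_injective
  have hcardR : (p : ℝ) ^ (m - 1) ≤ H.card := by exact_mod_cast hcard
  rw [← Finset.coe_image]
  rcases hc.2 (H.image toPlane) with ⟨L, hL, hrich⟩ | hmany
  · exfalso
    rw [hPc] at hrich
    -- A zero ceiling would, by truncated subtraction, turn the hypothesis into `200 < p ^ 0`.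
    obtain ⟨h, hh⟩ : ∃ h, ⌈(m : ℚ) / 2⌉₊ = h + 1 :=
      Nat.exists_eq_succ_of_ne_zero fun h0 => by simp [h0] at hpm
    rw [hh, Nat.add_sub_cancel] at hpm
    have hmh : 2 * h + 1 ≤ m := by
      have h1 : h < ⌈(m : ℚ) / 2⌉₊ := by omega
      rw [Nat.lt_ceil, lt_div_iff₀ (by norm_num)] at h1
      have : h * 2 < m := by exact_mod_cast h1
      omega
    set S := H.filter fun q => toPlane q ∈ L with hS
    have hSc : ((H.image toPlane : Finset Plane) ∩ (L : Set Plane) : Set Plane).ncard = S.card := by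
      rw [← Finset.card_image_of_injective S toPlane_injective, ← Set.ncard_coe_finset]
      congr 1
      ext x
      simp only [hS, Finset.coe_image, Set.mem_inter_iff, Set.mem_image, Finset.coe_filter,
        Set.mem_ofPred_eq, SetLike.mem_coe]
      constructor
      · rintro ⟨⟨q, hq, rfl⟩, hx⟩; exact ⟨q, ⟨hq, hx⟩, rfl⟩
      · rintro ⟨q, ⟨hq, hx⟩, rfl⟩; exact ⟨⟨q, hq, rfl⟩, hx⟩
    rw [hSc] at hrich
    have hle : S.card ≤ 2 * p ^ (m - (h + 1)) := by
      rcases le_or_gt S.card 1 with h1 | h1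
      · exact h1.trans (by have := Nat.pow_pos (n := m - (h + 1)) hp.pos; omega)
      · obtain ⟨q₁, hq₁, q₂, hq₂, hne⟩ := Finset.one_lt_card.1 h1
        obtain ⟨a, b, d, hab, hd⟩ := exists_integral_equation hL hne
          (Finset.mem_filter.1 hq₁).2 (Finset.mem_filter.1 hq₂).2
        refine card_hyperbola_line_le hp (by omega) hmh hab (fun q hq => ?_)
          fun q hq => hd q (Finset.mem_filter.1 hq).2
        exact ((Set.Finite.mem_toFinset hfin).1 (Finset.mem_filter.1 hq).1).1
    have hpow : p ^ (m - 1) = p ^ (m - (h + 1)) * p ^ h := by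
      rw [← pow_add]; congr 1; omega
    have hpos := Nat.pow_pos (n := m - (h + 1)) hp.pos
    -- The factor `200` is the `100` of alternative (i) times the two residue classes.
    have hlt : 200 * p ^ (m - (h + 1)) < p ^ (m - 1) := by
      rw [hpow, mul_comm]
      exact Nat.mul_lt_mul_of_pos_left hpm hpos
    rw [div_le_iff₀ (by norm_num)] at hrich
    have : H.card ≤ S.card * 100 := by exact_mod_cast hrich
    omega
  · refine le_trans ?_ hmany
    rw [hPc, mul_comm 2, pow_mul]
    exact mul_le_mul_of_nonneg_left (pow_le_pow_left₀ (by positivity) hcardR 2) hc.1.le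

theorem corollary12 :
    (∃ c : ℝ, IsBeckConstant c) ∧
    ∀ c : ℝ, IsBeckConstant c →
      ∀ p m : ℕ, p.Prime → 1 ≤ m → 200 < p ^ (⌈(m : ℚ) / 2⌉₊ - 1) →
        ∀ i : ℕ, 1 ≤ i → i ≤ p - 1 →
          c * (p : ℝ) ^ (2 * (m - 1)) ≤
            ((spannedLines (toPlane '' hyperbolaClass p m i)).ncard : ℝ) :=
  ⟨⟨_, isBeckConstant_inv⟩, fun _ hc _ _ hp hm hpm _ hi hip =>
    beck_hyperbolaClass hc hp hm hpm hi hip⟩
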